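/- Let $S$ be a set of $n$ points in the plane $\mathbb{R}^2$ in general position (no three distinct points of $S$ are collinear), and let $\mathsf{K}_n$ be the complete geometric graph defined over $S$: its vertex set is $S$, and its edges are the straight-line segments joining the pairs of distinct points of $S$. A $K_4$-crossing family of $\mathsf{K}_n$ is a family of pairwise vertex-disjoint subgraphs of $\mathsf{K}_n$, each isomorphic to the complete graph $K_4$, such that any two distinct members $\mathsf{A}$, $\mathsf{B}$ of the family cross, i.e. there are an edge of $\mathsf{A}$ and an edge of $\mathsf{B}$ that have exactly one interior point in common. Then $\mathsf{K}_n$ contains a $K_4$-crossing family of size at least $\frac{n}{4}-6$. This is tight up to the additive constant: every $K_4$-crossing family of $\mathsf{K}_n$ has size at most $\frac{n}{4}$. -/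

import Mathlib

/-- The Euclidean plane `ℝ²`. -/
abbrev Plane : Type := EuclideanSpace ℝ (Fin 2)

/-- A set of points is in general position if no three distinct points of it are collinear. -/
def InGeneralPosition (S : Set Plane) : Prop :=
  ∀ a ∈ S, ∀ b ∈ S, ∀ c ∈ S, a ≠ b → a ≠ c → b ≠ c → ¬ Collinear ℝ ({a, b, c} : Set Plane)

/-- A graph whose vertices are points of the plane; the edge `uv` is drawn as the straight
segment from `u` to `v`. -/
abbrev PlaneGraph : Type := (⊤ : SimpleGraph Plane).Subgraph

/-- A geometric graph: finitely many points of the plane as vertices, edges that are segments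
between two distinct vertices, and no vertex in the interior of an edge. -/
structure GeometricGraph where
  graph : PlaneGraph
  finite_verts : graph.verts.Finite
  interior_edge : ∀ u v, graph.Adj u v → ∀ w ∈ graph.verts, w ∉ openSegment ℝ u v

/-- The complete geometric graph defined over a finite point set in general position. -/
def completeGeometricGraph (S : Finset Plane) (hS : InGeneralPosition (S : Set Plane)) :
    GeometricGraph where
  graph :=
    { verts := (S : Set Plane)
      Adj := fun u v => u ∈ S ∧ v ∈ S ∧ u ≠ v
      adj_sub := fun h => h.2.2
      edge_vert := fun h => h.1
      symm := ⟨fun _ _ h => ⟨h.2.1, h.1, h.2.2.symm⟩⟩ }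
  finite_verts := S.finite_toSet
  interior_edge := by
    rintro u v ⟨hu, hv, huv⟩ w hw hmem
    have h1 : u ≠ w := by
      rintro rfl
      exact huv (left_mem_openSegment_iff.1 hmem)
    have h2 : w ≠ v := by
      rintro rfl
      exact huv (right_mem_openSegment_iff.1 hmem)
    exact hS u hu w hw v hv h1 huv h2
      (mem_segment_iff_wbtw.1 (openSegment_subset_segment ℝ u v hmem)).collinear

/-- Two graphs drawn in the plane cross if some edge of the first and some edge of the second
have exactly one interior point in common. -/
def PlaneGraph.Cross (A B : PlaneGraph) : Prop :=
  ∃ a b c d, A.Adj a b ∧ B.Adj c d ∧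
    ∃ x, openSegment ℝ a b ∩ openSegment ℝ c d = {x}

/-- `F` is an `H`-crossing family of the geometric graph `G`: a family of subgraphs of `G`, each
isomorphic to `H`, which are pairwise vertex-disjoint and pairwise crossing. -/
structure IsCrossingFamily {W : Type*} (G : GeometricGraph) (H : SimpleGraph W)
    (F : Finset PlaneGraph) : Prop where
  subgraph : ∀ A ∈ F, A ≤ G.graph
  iso : ∀ A ∈ F, Nonempty (H ≃g A.coe)
  disjoint : ∀ A ∈ F, ∀ B ∈ F, A ≠ B → Disjoint A.verts B.verts
  cross : ∀ A ∈ F, ∀ B ∈ F, A ≠ B → PlaneGraph.Cross A B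

theorem exists_mem_segment_of_mem_frontier_convexHull {s : Set Plane} (hs : s.Finite) {x : Plane}
    (hx : x ∈ frontier (convexHull ℝ s)) : ∃ a ∈ s, ∃ b ∈ s, x ∈ segment ℝ a b := by
  have hxs : x ∈ convexHull ℝ s := (hs.isCompact_convexHull ℝ).isClosed.frontier_subset hx
  obtain ⟨ι, _, z, w, hz, hind, hw, hw1, hxz⟩ := eq_pos_convex_span_of_mem_convexHull hxs
  have hcard : Fintype.card ι ≤ 3 := by
    have h1 := hind.card_le_finrank_succ
    have h2 := Submodule.finrank_le (vectorSpan ℝ (Set.range z))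
    rw [finrank_euclideanSpace_fin] at h2
    omega
  have hz' : ∀ i, z i ∈ s := fun i => hz ⟨i, rfl⟩
  interval_cases hι : Fintype.card ι
  · have : IsEmpty ι := Fintype.card_eq_zero_iff.1 hι
    simp at hw1
  · obtain ⟨i, hi⟩ := Finset.card_eq_one.1 (Finset.card_univ.trans hι)
    rw [hi, Finset.sum_singleton] at hw1 hxz
    rw [hw1, one_smul] at hxz
    exact ⟨z i, hz' i, z i, hz' i, by simp [hxz]⟩
  · classical
    obtain ⟨i, j, hij, hu⟩ := Finset.card_eq_two.1 (Finset.card_univ.trans hι)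
    rw [hu, Finset.sum_pair hij] at hw1 hxz
    exact ⟨z i, hz' i, z j, hz' j, w i, w j, (hw i).le, (hw j).le, hw1, hxz⟩
  · have htop : affineSpan ℝ (Set.range z) = ⊤ := by
      rw [hind.affineSpan_eq_top_iff_card_eq_finrank_add_one, finrank_euclideanSpace_fin, hι]
    let b : AffineBasis ι ℝ Plane := ⟨z, hind, htop⟩
    have hb : x ∈ interior (convexHull ℝ (Set.range b)) := by
      rw [b.interior_convexHull]
      intro i
      have hc := b.coord_apply_combination_of_mem (Finset.mem_univ i) hw1
      rw [Finset.affineCombination_eq_linear_combination _ _ _ hw1] at hc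
      change b.coord i (∑ i, w i • z i) = w i at hc
      rw [← hxz, hc]
      exact hw i
    exact absurd (interior_mono (convexHull_mono hz) hb) hx.2

theorem exists_mem_segment_mem_frontier {K : Set Plane} {p q : Plane} (hp : p ∈ K) (hq : q ∉ K) :
    ∃ x ∈ segment ℝ p q, x ∈ frontier K := by
  by_contra! h
  have hpre := (convex_segment (𝕜 := ℝ) p q).isPreconnected
  have hsub : segment ℝ p q ⊆ interior K ∪ (closure K)ᶜ := by
    intro x hx
    by_cases hc : x ∈ closure K
    · exact Or.inl (by_contra fun hi => h x hx ⟨hc, hi⟩)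
    · exact Or.inr hc
  obtain ⟨x, -, hx1, hx2⟩ := hpre _ _ isOpen_interior isClosed_closure.isOpen_compl hsub
    ⟨p, left_mem_segment ℝ p q, (hsub (left_mem_segment ℝ p q)).resolve_right
      fun hn => hn (subset_closure hp)⟩
    ⟨q, right_mem_segment ℝ p q, (hsub (right_mem_segment ℝ p q)).resolve_left
      fun hn => hq (interior_subset hn)⟩
  exact hx2 (subset_closure (interior_subset hx1))

/-- If a convex hull contains a point of one edge spanned by `B` but misses a point of `B`, then
some edge spanned by `B` meets an edge spanned by `A`. -/
theorem exists_segment_inter_segment {A B : Set Plane} (hA : A.Finite) {s s' q v : Plane}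
    (hs : s ∈ B) (hs' : s' ∈ B) (hss : s ≠ s') (hq : q ∈ segment ℝ s s')
    (hqA : q ∈ convexHull ℝ A) (hv : v ∈ B) (hvA : v ∉ convexHull ℝ A) :
    ∃ a ∈ A, ∃ b ∈ A, ∃ c ∈ B, ∃ d ∈ B, c ≠ d ∧ ∃ x, x ∈ segment ℝ a b ∧ x ∈ segment ℝ c d := by
  by_cases hsA : s ∈ convexHull ℝ A
  · obtain ⟨x, hx, hxf⟩ := exists_mem_segment_mem_frontier hsA hvA
    obtain ⟨a, ha, b, hb, hab⟩ := exists_mem_segment_of_mem_frontier_convexHull hA hxf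
    exact ⟨a, ha, b, hb, s, hs, v, hv, fun h => hvA (h ▸ hsA), x, hab, hx⟩
  · obtain ⟨x, hx, hxf⟩ := exists_mem_segment_mem_frontier hqA hsA
    obtain ⟨a, ha, b, hb, hab⟩ := exists_mem_segment_of_mem_frontier_convexHull hA hxf
    exact ⟨a, ha, b, hb, s, hs, s', hs', hss, x, hab,
      (convex_segment s s').segment_subset hq (left_mem_segment ℝ s s') hx⟩

theorem InGeneralPosition.notMem_segment {S : Set Plane} (hS : InGeneralPosition S)
    {a b c : Plane} (ha : a ∈ S) (hb : b ∈ S) (hc : c ∈ S) (hab : a ≠ b) (hac : a ≠ c)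
    (hbc : b ≠ c) : a ∉ segment ℝ b c := fun h =>
  hS b hb a ha c hc hab.symm hbc hac (mem_segment_iff_wbtw.1 h).collinear

/-- In general position, two segments on four different endpoints that meet have exactly one common
point, and it is interior to both. -/
theorem InGeneralPosition.openSegment_inter_eq_singleton {S : Set Plane}
    (hS : InGeneralPosition S) {a b c d x : Plane} (ha : a ∈ S) (hb : b ∈ S) (hc : c ∈ S)
    (hd : d ∈ S) (hac : a ≠ c) (had : a ≠ d) (hbc : b ≠ c) (hbd : b ≠ d) (hcd : c ≠ d)
    (hab' : x ∈ segment ℝ a b) (hcd' : x ∈ segment ℝ c d) :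
    a ≠ b ∧ ∃ x, openSegment ℝ a b ∩ openSegment ℝ c d = {x} := by
  have hxa : x ≠ a := by
    rintro rfl
    exact hS.notMem_segment ha hc hd hac had hcd hcd'
  have hxb : x ≠ b := by
    rintro rfl
    exact hS.notMem_segment hb hc hd hbc hbd hcd hcd'
  have hab : a ≠ b := by
    rintro rfl
    simp only [segment_same, Set.mem_singleton_iff] at hab'
    exact hxa hab'
  have hxc : x ≠ c := by
    rintro rfl
    exact hS.notMem_segment hc ha hb hac.symm hbc.symm hab hab'
  have hxd : x ≠ d := by
    rintro rfl
    exact hS.notMem_segment hd ha hb had.symm hbd.symm hab hab'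
  refine ⟨hab, x, Set.Subset.antisymm ?_ ?_⟩
  · rintro y ⟨hy1, hy2⟩
    by_contra hne
    have hline : ∀ {p q r : Plane}, r ∈ segment ℝ p q → r ∈ line[ℝ, p, q] := fun h =>
      (mem_segment_iff_wbtw.1 h).mem_affineSpan
    have h1 := hline hab'
    have h2 := hline hcd'
    have h3 := hline (openSegment_subset_segment ℝ _ _ hy1)
    have h4 := hline (openSegment_subset_segment ℝ _ _ hy2)
    have e1 := affineSpan_pair_eq_of_mem_of_mem_of_ne h1 h3 (Ne.symm hne)
    have e2 := affineSpan_pair_eq_of_mem_of_mem_of_ne h2 h4 (Ne.symm hne)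
    have h5 : c ∈ line[ℝ, a, b] := by
      rw [← e1, e2]
      exact left_mem_affineSpan_pair ℝ c d
    exact hS c hc a ha b hb hac.symm hbc.symm hab (collinear_insert_of_mem_affineSpan_pair h5)
  · rintro y rfl
    exact ⟨mem_openSegment_of_ne_left_right hxa.symm hxb.symm hab',
      mem_openSegment_of_ne_left_right hxc.symm hxd.symm hcd'⟩

/-- The complete graph on a set of points. -/
def completeOn (V : Set Plane) : PlaneGraph where
  verts := V
  Adj u v := u ∈ V ∧ v ∈ V ∧ u ≠ v
  adj_sub h := h.2.2
  edge_vert h := h.1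
  symm := ⟨fun _ _ h => ⟨h.2.1, h.1, h.2.2.symm⟩⟩

theorem completeOn_iso {V : Finset Plane} {k : ℕ} (hV : V.card = k) :
    Nonempty ((⊤ : SimpleGraph (Fin k)) ≃g (completeOn (V : Set Plane)).coe) := by
  let e : Fin k ≃ V := (V.equivFinOfCardEq hV).symm
  refine ⟨⟨e, ?_⟩⟩
  intro i j
  change ((e i : Plane) ∈ V ∧ (e j : Plane) ∈ V ∧ (e i : Plane) ≠ (e j : Plane)) ↔ i ≠ j
  simp

theorem PlaneGraph.Cross.symm {A B : PlaneGraph} (h : A.Cross B) : B.Cross A := by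
  obtain ⟨a, b, c, d, hab, hcd, x, hx⟩ := h
  exact ⟨c, d, a, b, hcd, hab, x, by rw [Set.inter_comm, hx]⟩

theorem InGeneralPosition.cross_completeOn {S A B : Set Plane} (hS : InGeneralPosition S)
    (hA : A ⊆ S) (hB : B ⊆ S) (hAB : Disjoint A B)
    (h : ∃ a ∈ A, ∃ b ∈ A, ∃ c ∈ B, ∃ d ∈ B, c ≠ d ∧
      ∃ x, x ∈ segment ℝ a b ∧ x ∈ segment ℝ c d) :
    (completeOn A).Cross (completeOn B) := by
  obtain ⟨a, ha, b, hb, c, hc, d, hd, hcd, x, hxab, hxcd⟩ := h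
  have hne : ∀ {p q}, p ∈ A → q ∈ B → p ≠ q := fun hp hq => hAB.ne_of_mem hp hq
  obtain ⟨hab, hx⟩ := hS.openSegment_inter_eq_singleton (hA ha) (hA hb) (hB hc) (hB hd)
    (hne ha hc) (hne ha hd) (hne hb hc) (hne hb hd) hcd hxab hxcd
  exact ⟨a, b, c, d, ⟨ha, hb, hab⟩, ⟨hc, hd, hcd⟩, hx⟩

theorem IsCrossingFamily.four_mul_card_le {S : Finset Plane} {hS : InGeneralPosition (S : Set Plane)}
    {F : Finset PlaneGraph}
    (hF : IsCrossingFamily (completeGeometricGraph S hS) (⊤ : SimpleGraph (Fin 4)) F) :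
    4 * F.card ≤ S.card := by
  classical
  have hsub : ∀ A ∈ F, ∀ v ∈ A.verts, v ∈ S := fun A hA v hv => (hF.subgraph A hA).1 hv
  let V : PlaneGraph → Finset Plane := fun A => S.filter (· ∈ A.verts)
  have hVcard : ∀ A ∈ F, (V A).card = 4 := by
    intro A hA
    obtain ⟨e⟩ := hF.iso A hA
    have h1 : (V A : Set Plane) = A.verts := by
      ext v
      simpa [V] using hsub A hA v
    rw [← Set.ncard_coe_finset, h1, ← Nat.card_coe_set_eq, ← Nat.card_congr e.toEquiv]
    simp
  have hdisj : (F : Set PlaneGraph).PairwiseDisjoint V := by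
    intro A hA B hB hAB
    refine Finset.disjoint_left.2 fun v hv hv' => ?_
    exact Set.disjoint_left.1 (hF.disjoint A hA B hB hAB) (Finset.mem_filter.1 hv).2
      (Finset.mem_filter.1 hv').2
  have h := Finset.card_le_card (Finset.biUnion_subset.2 fun A (_ : A ∈ F) =>
    Finset.filter_subset (· ∈ A.verts) S)
  rw [Finset.card_biUnion hdisj, Finset.sum_congr rfl hVcard] at h
  simpa [mul_comm] using h

theorem exists_mem_segment_apply_eq (u : Plane →ₗ[ℝ] ℝ) {a b : Plane} {α : ℝ} (hb : u b < α)
    (ha : α < u a) : ∃ q ∈ segment ℝ b a, u q = α := by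
  have hpos : 0 < u a - u b := by linarith
  refine ⟨((u a - α) / (u a - u b)) • b + ((α - u b) / (u a - u b)) • a,
    ⟨_, _, div_nonneg (by linarith) hpos.le, div_nonneg (by linarith) hpos.le, ?_, rfl⟩, ?_⟩
  · field_simp
    ring
  · simp only [map_add, map_smul, smul_eq_mul]
    field_simp
    ring

theorem mem_segment_of_apply_eq {u w : Plane →ₗ[ℝ] ℝ}
    (huw : ∀ p q, u p = u q → w p = w q → p = q) {p q x : Plane} {α : ℝ} (hp : u p = α)
    (hq : u q = α) (hx : u x = α) (hpx : w p < w x) (hxq : w x ≤ w q) : x ∈ segment ℝ p q := by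
  have hpos : 0 < w q - w p := by linarith
  refine ⟨(w q - w x) / (w q - w p), (w x - w p) / (w q - w p),
    div_nonneg (by linarith) hpos.le, div_nonneg (by linarith) hpos.le, ?_, huw _ _ ?_ ?_⟩
  · field_simp
    ring
  · simp only [map_add, map_smul, smul_eq_mul, hp, hq, hx]
    field_simp
    ring
  · simp only [map_add, map_smul, smul_eq_mul]
    field_simp
    ring

/-- The points `a`, `b`, `c`, `d` lie in the four open quadrants, in counterclockwise order, cut out
by the lines `u = α` and `w = β`. -/
structure InQuadrants (u w : Plane →ₗ[ℝ] ℝ) (α β : ℝ) (a b c d : Plane) : Prop where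
  ua : α < u a
  wa : β < w a
  ub : u b < α
  wb : β < w b
  uc : u c < α
  wc : w c < β
  ud : α < u d
  wd : w d < β

namespace InQuadrants

variable {u w : Plane →ₗ[ℝ] ℝ} {α β : ℝ} {a b c d a' b' c' d' : Plane}

theorem exists_upper (h : InQuadrants u w α β a b c d) :
    ∃ q ∈ segment ℝ b a, u q = α ∧ β < w q := by
  obtain ⟨q, hq, hu⟩ := exists_mem_segment_apply_eq u h.ub h.ua
  exact ⟨q, hq, hu, (convex_halfSpace_gt w.isLinear β).segment_subset h.wb h.wa hq⟩

theorem exists_lower (h : InQuadrants u w α β a b c d) :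
    ∃ q ∈ segment ℝ c d, u q = α ∧ w q < β := by
  obtain ⟨q, hq, hu⟩ := exists_mem_segment_apply_eq u h.uc h.ud
  exact ⟨q, hq, hu, (convex_halfSpace_lt w.isLinear β).segment_subset h.wc h.wd hq⟩

theorem mem_convexHull (h : InQuadrants u w α β a b c d)
    (huw : ∀ p q, u p = u q → w p = w q → p = q) {q x : Plane} (hq : q ∈ segment ℝ b a)
    (hqu : u q = α) (hxu : u x = α) (hβ : β < w x) (hx : w x ≤ w q) :
    x ∈ convexHull ℝ ({a, b, c, d} : Set Plane) := by
  obtain ⟨p, hp, hpu, hpw⟩ := h.exists_lower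
  have hconv := convex_convexHull ℝ ({a, b, c, d} : Set Plane)
  have hsub := subset_convexHull ℝ ({a, b, c, d} : Set Plane)
  have hp' := hconv.segment_subset (hsub (by simp)) (hsub (by simp)) hp
  have hq' := hconv.segment_subset (hsub (by simp)) (hsub (by simp)) hq
  exact hconv.segment_subset hp' hq' (mem_segment_of_apply_eq huw hpu hqu hxu (by linarith) hx)

/-- Two quadrilaterals around a common centre, one of which is shifted to the right of the other,
have intersecting edges. -/
theorem exists_segments_meet (h : InQuadrants u w α β a b c d)
    (h' : InQuadrants u w α β a' b' c' d') (huw : ∀ p q, u p = u q → w p = w q → p = q)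
    (ha : u a < u a') (hb : u b < u b') (hc : u c < u c') (hd : u d < u d') :
    (∃ p ∈ ({a, b, c, d} : Set Plane), ∃ q ∈ ({a, b, c, d} : Set Plane),
      ∃ r ∈ ({a', b', c', d'} : Set Plane), ∃ s ∈ ({a', b', c', d'} : Set Plane), r ≠ s ∧
        ∃ x, x ∈ segment ℝ p q ∧ x ∈ segment ℝ r s) ∨
    (∃ p ∈ ({a', b', c', d'} : Set Plane), ∃ q ∈ ({a', b', c', d'} : Set Plane),
      ∃ r ∈ ({a, b, c, d} : Set Plane), ∃ s ∈ ({a, b, c, d} : Set Plane), r ≠ s ∧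
        ∃ x, x ∈ segment ℝ p q ∧ x ∈ segment ℝ r s) := by
  obtain ⟨q, hq, hqu, hqw⟩ := h.exists_upper
  obtain ⟨q', hq', hqu', hqw'⟩ := h'.exists_upper
  have := h.ua; have := h.ub; have := h.uc; have := h.ud
  have := h'.ua; have := h'.ub; have := h'.uc; have := h'.ud
  rcases le_total (w q') (w q) with hle | hle
  · left
    have hmem := h.mem_convexHull huw hq hqu hqu' hqw' hle
    obtain ⟨v, hv, hva, hvd⟩ : ∃ v ∈ ({a', b', c', d'} : Set Plane), u a' ≤ u v ∧ u d' ≤ u v := by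
      rcases le_total (u a') (u d') with h1 | h1
      · exact ⟨d', by simp, h1, le_rfl⟩
      · exact ⟨a', by simp, le_rfl, h1⟩
    refine exists_segment_inter_segment (by simp) (s := b') (s' := a') (by simp) (by simp) ?_
      hq' hmem hv ?_
    · rintro rfl
      linarith
    · intro hvA
      have hsub : convexHull ℝ ({a, b, c, d} : Set Plane) ⊆ {p | u p < u v} := by
        refine convexHull_min ?_ (convex_halfSpace_lt u.isLinear (u v))
        rintro p (rfl | rfl | rfl | rfl) <;> simp only [Set.mem_ofPred_eq] <;> linarith
      exact lt_irrefl (u v) (hsub hvA)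
  · right
    have hmem := h'.mem_convexHull huw hq' hqu' hqu hqw hle
    obtain ⟨v, hv, hvb, hvc⟩ : ∃ v ∈ ({a, b, c, d} : Set Plane), u v ≤ u b ∧ u v ≤ u c := by
      rcases le_total (u b) (u c) with h1 | h1
      · exact ⟨b, by simp, le_rfl, h1⟩
      · exact ⟨c, by simp, h1, le_rfl⟩
    refine exists_segment_inter_segment (by simp) (s := b) (s' := a) (by simp) (by simp) ?_
      hq hmem hv ?_
    · rintro rfl
      linarith
    · intro hvA
      have hsub : convexHull ℝ ({a', b', c', d'} : Set Plane) ⊆ {p | u v < u p} := by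
        refine convexHull_min ?_ (convex_halfSpace_gt u.isLinear (u v))
        rintro p (rfl | rfl | rfl | rfl) <;> simp only [Set.mem_ofPred_eq] <;> linarith
      exact lt_irrefl (u v) (hsub hvA)

theorem disjoint (h : InQuadrants u w α β a b c d) (h' : InQuadrants u w α β a' b' c' d')
    (ha : a ≠ a') (hb : b ≠ b') (hc : c ≠ c') (hd : d ≠ d') :
    Disjoint ({a, b, c, d} : Set Plane) {a', b', c', d'} := by
  obtain ⟨h1, h2, h3, h4, h5, h6, h7, h8⟩ := h
  obtain ⟨k1, k2, k3, k4, k5, k6, k7, k8⟩ := h'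
  refine Set.disjoint_left.2 ?_
  rintro p (rfl | rfl | rfl | rfl) (rfl | rfl | rfl | rfl) <;>
    first | contradiction | linarith

theorem card_eq [DecidableEq Plane] (h : InQuadrants u w α β a b c d) :
    ({a, b, c, d} : Finset Plane).card = 4 := by
  obtain ⟨h1, h2, h3, h4, h5, h6, h7, h8⟩ := h
  have hu : ∀ {p q : Plane}, u p < u q → p ≠ q := by
    rintro p q hpq rfl
    exact lt_irrefl _ hpq
  have hw : ∀ {p q : Plane}, w p < w q → p ≠ q := by
    rintro p q hpq rfl
    exact lt_irrefl _ hpq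
  have e1 : a ≠ b := (hu (h3.trans h1)).symm
  have e2 : a ≠ c := (hu (h5.trans h1)).symm
  have e3 : a ≠ d := (hw (h8.trans h2)).symm
  have e4 : b ≠ c := (hw (h6.trans h4)).symm
  have e5 : b ≠ d := hu (h3.trans h7)
  have e6 : c ≠ d := hu (h5.trans h7)
  rw [Finset.card_insert_of_notMem (by simp [e1, e2, e3]),
    Finset.card_insert_of_notMem (by simp [e4, e5]), Finset.card_pair e6]

end InQuadrants

/-- Finitely many continuously moving reals, `2 * t + 1` in number, have a continuous median. -/
theorem exists_continuous_median {ι : Type*} (L : Finset ι) {t : ℕ} (hL : L.card = 2 * t + 1)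
    (v : ℝ → ι → ℝ) (hv : ∀ p, Continuous fun m => v m p) :
    ∃ φ : ℝ → ℝ, Continuous φ ∧ ∀ m, (L.filter fun p => v m p < φ m).card ≤ t ∧
      (L.filter fun p => φ m < v m p).card ≤ t ∧ ∃ p ∈ L, v m p = φ m := by
  classical
  let P := L.powersetCard (t + 1)
  have hmem : ∀ T : P, T.1 ⊆ L ∧ T.1.card = t + 1 := fun T => Finset.mem_powersetCard.1 T.2
  have hne : ∀ T : P, T.1.Nonempty := fun T => Finset.card_pos.1 (by rw [(hmem T).2]; omega)
  have hP : P.attach.Nonempty := by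
    rw [Finset.attach_nonempty_iff]
    exact Finset.powersetCard_nonempty.2 (by omega)
  let φ : ℝ → ℝ := fun m => P.attach.inf' hP fun T => T.1.sup' (hne T) fun p => v m p
  refine ⟨φ, Continuous.finset_inf'_apply hP fun T _ =>
    Continuous.finset_sup'_apply (hne T) fun p _ => hv p, fun m => ?_⟩
  obtain ⟨T, -, hT⟩ := Finset.exists_mem_eq_inf' hP fun T : P => T.1.sup' (hne T) fun p => v m p
  change φ m = _ at hT
  refine ⟨?_, ?_, ?_⟩
  · by_contra! hlt
    obtain ⟨T', hT', hc⟩ := Finset.exists_subset_card_eq (Nat.succ_le_of_lt hlt)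
    have hT'P : T' ∈ P :=
      Finset.mem_powersetCard.2 ⟨hT'.trans (Finset.filter_subset _ _), hc⟩
    have h1 : φ m ≤ T'.sup' (hne ⟨T', hT'P⟩) fun p => v m p :=
      Finset.inf'_le (fun T : P => T.1.sup' (hne T) fun p => v m p)
        (Finset.mem_attach _ ⟨T', hT'P⟩)
    have h2 : (T'.sup' (hne ⟨T', hT'P⟩) fun p => v m p) < φ m :=
      (Finset.sup'_lt_iff _).2 fun p hp => (Finset.mem_filter.1 (hT' hp)).2
    linarith
  · have hsub : (L.filter fun p => φ m < v m p) ⊆ L \ T.1 := by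
      intro p hp
      rw [Finset.mem_filter] at hp
      refine Finset.mem_sdiff.2 ⟨hp.1, fun hpT => ?_⟩
      have := Finset.le_sup' (fun p => v m p) hpT
      rw [← hT] at this
      linarith [hp.2]
    have := Finset.card_le_card hsub
    rw [Finset.card_sdiff_of_subset (hmem T).1, (hmem T).2] at this
    omega
  · obtain ⟨p, hp, hpe⟩ := Finset.exists_mem_eq_sup' (hne T) fun p => v m p
    exact ⟨p, (hmem T).1 hp, (hT.trans hpe).symm⟩

/-- A ham-sandwich line for two point sets separated by a vertical line. -/
theorem exists_bisecting_line {ι : Type*} (L R : Finset ι) {t : ℕ} (hL : L.card = 2 * t + 1)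
    (hR : R.card = 2 * t + 1) (f y : ι → ℝ) (hLR : ∀ l ∈ L, ∀ r ∈ R, f l < f r) :
    ∃ m h : ℝ, (L.filter fun p => y p - m * f p < h).card ≤ t ∧
      (L.filter fun p => h < y p - m * f p).card ≤ t ∧
      (R.filter fun p => y p - m * f p < h).card ≤ t ∧
      (R.filter fun p => h < y p - m * f p).card ≤ t := by
  have hcont : ∀ p, Continuous fun m : ℝ => y p - m * f p := fun p => by fun_prop
  obtain ⟨φ, hφ, hφ'⟩ := exists_continuous_median L hL (fun m p => y p - m * f p) hcont
  obtain ⟨ψ, hψ, hψ'⟩ := exists_continuous_median R hR (fun m p => y p - m * f p) hcont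
  obtain ⟨M, hM⟩ := ((L ×ˢ R).image fun x => |(y x.2 - y x.1) / (f x.2 - f x.1)|).exists_le
  have hM' : ∀ l ∈ L, ∀ r ∈ R, |y r - y l| ≤ M * (f r - f l) := by
    intro l hl r hr
    have h1 := hM _ (Finset.mem_image_of_mem _ (Finset.mk_mem_product hl hr))
    have h2 : 0 < f r - f l := sub_pos.2 (hLR l hl r hr)
    simp only [abs_div, abs_of_pos h2] at h1
    exact (div_le_iff₀ h2).1 h1
  have hpos : ψ M - φ M ≤ 0 := by
    obtain ⟨l, hl, hle⟩ := (hφ' M).2.2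
    obtain ⟨r, hr, hre⟩ := (hψ' M).2.2
    linarith [(abs_le.1 (hM' l hl r hr)).2]
  have hneg : 0 ≤ ψ (-M) - φ (-M) := by
    obtain ⟨l, hl, hle⟩ := (hφ' (-M)).2.2
    obtain ⟨r, hr, hre⟩ := (hψ' (-M)).2.2
    linarith [(abs_le.1 (hM' l hl r hr)).1]
  obtain ⟨m, hm⟩ := intermediate_value_univ M (-M) (hψ.sub hφ) ⟨hpos, hneg⟩
  have he : ψ m = φ m := sub_eq_zero.1 hm
  refine ⟨m, φ m, (hφ' m).1, (hφ' m).2.1, ?_, ?_⟩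
  · exact he ▸ (hψ' m).1
  · exact he ▸ (hψ' m).2.1

theorem exists_strictMono_enum {ι : Type*} {Q : Finset ι} {f : ι → ℝ}
    (hf : Set.InjOn f (Q : Set ι)) {k : ℕ} (hk : k ≤ Q.card) :
    ∃ e : Fin k → ι, (∀ i, e i ∈ Q) ∧ StrictMono fun i => f (e i) := by
  classical
  obtain ⟨Q', hQ', hcard⟩ := Finset.exists_subset_card_eq hk
  have hc : (Q'.image f).card = k := by
    rw [Finset.card_image_of_injOn (hf.mono (by exact_mod_cast hQ')), hcard]
  have h : ∀ i, ∃ p ∈ Q', f p = (Q'.image f).orderEmbOfFin hc i := fun i =>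
    Finset.mem_image.1 (Finset.orderEmbOfFin_mem _ hc i)
  choose e he hfe using h
  exact ⟨e, fun i => hQ' (he i), fun i j hij => by
    simpa only [hfe] using ((Q'.image f).orderEmbOfFin hc).strictMono hij⟩

theorem exists_separated_subsets {ι : Type*} {Q : Finset ι} {f : ι → ℝ}
    (hf : Set.InjOn f (Q : Set ι)) {k : ℕ} (hk : 2 * k + 1 ≤ Q.card) :
    ∃ (α : ℝ) (L R : Finset ι), L ⊆ Q ∧ R ⊆ Q ∧ L.card = k ∧ R.card = k ∧
      (∀ p ∈ L, f p < α) ∧ ∀ p ∈ R, α < f p := by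
  classical
  obtain ⟨e, heQ, he⟩ := exists_strictMono_enum hf hk
  have hinj : Function.Injective e := fun i j hij => he.injective (congrArg f hij)
  let l : Fin k → Fin (2 * k + 1) := fun i => ⟨i, by omega⟩
  let r : Fin k → Fin (2 * k + 1) := fun i => ⟨k + 1 + i, by omega⟩
  have hl : Function.Injective l := fun i j hij => by
    simp only [l, Fin.mk.injEq] at hij
    omega
  have hr : Function.Injective r := fun i j hij => by
    simp only [r, Fin.mk.injEq] at hij
    omega
  refine ⟨f (e ⟨k, by omega⟩), Finset.univ.image (e ∘ l), Finset.univ.image (e ∘ r),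
    ?_, ?_, ?_, ?_, ?_, ?_⟩
  · exact Finset.image_subset_iff.2 fun i _ => heQ _
  · exact Finset.image_subset_iff.2 fun i _ => heQ _
  · rw [Finset.card_image_of_injective _ (hinj.comp hl), Finset.card_fin]
  · rw [Finset.card_image_of_injective _ (hinj.comp hr), Finset.card_fin]
  · intro p hp
    obtain ⟨i, -, rfl⟩ := Finset.mem_image.1 hp
    exact he (Fin.mk_lt_mk.2 i.2)
  · intro p hp
    obtain ⟨i, -, rfl⟩ := Finset.mem_image.1 hp
    exact he (Fin.mk_lt_mk.2 (by omega))

theorem exists_injOn_shear (S : Finset Plane) :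
    ∃ ε : ℝ, Set.InjOn (fun p : Plane => p 0 + ε * p 1) (S : Set Plane) := by
  classical
  obtain ⟨ε, hε⟩ := Infinite.exists_notMem_finset
    ((S ×ˢ S).image fun x => -(x.1 0 - x.2 0) / (x.1 1 - x.2 1))
  refine ⟨ε, fun p hp q hq hpq => ?_⟩
  simp only at hpq
  have h1 : p 1 = q 1 := by
    by_contra hne
    refine hε (Finset.mem_image.2 ⟨(p, q), Finset.mk_mem_product hp hq, ?_⟩)
    rw [div_eq_iff (sub_ne_zero.2 hne)]
    linarith
  ext i
  fin_cases i
  · rw [h1] at hpq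
    exact add_right_cancel hpq
  · exact h1

/-- Four sheared coordinate quadrants split a point set in general position almost evenly. -/
theorem InGeneralPosition.exists_quadrants {S : Finset Plane}
    (hS : InGeneralPosition (S : Set Plane)) {k : ℕ} (hk : 4 * k + 7 ≤ S.card) :
    ∃ (u w : Plane →ₗ[ℝ] ℝ) (α β : ℝ) (a b c d : Fin k → Plane),
      (∀ p q, u p = u q → w p = w q → p = q) ∧
      (∀ i, InQuadrants u w α β (a i) (b i) (c i) (d i)) ∧
      (∀ i, a i ∈ S ∧ b i ∈ S ∧ c i ∈ S ∧ d i ∈ S) ∧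
      (StrictMono fun i => u (a i)) ∧ (StrictMono fun i => u (b i)) ∧
      (StrictMono fun i => u (c i)) ∧ StrictMono fun i => u (d i) := by
  classical
  obtain ⟨ε, hε⟩ := exists_injOn_shear S
  obtain ⟨α, L, R, hLS, hRS, hL, hR, hLα, hRα⟩ :=
    exists_separated_subsets hε (k := 2 * (k + 1) + 1) (by omega)
  obtain ⟨m, β, hL1, hL2, hR1, hR2⟩ := exists_bisecting_line L R hL hR
    (fun p : Plane => p 0 + ε * p 1) (fun p : Plane => p 1)
    fun l hl r hr => (hLα l hl).trans (hRα r hr)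
  let x : Plane →ₗ[ℝ] ℝ := (EuclideanSpace.proj (0 : Fin 2) : Plane →L[ℝ] ℝ)
  let y : Plane →ₗ[ℝ] ℝ := (EuclideanSpace.proj (1 : Fin 2) : Plane →L[ℝ] ℝ)
  let u : Plane →ₗ[ℝ] ℝ := x + ε • y
  let w : Plane →ₗ[ℝ] ℝ := y - m • u
  have hu : ∀ p : Plane, u p = p 0 + ε * p 1 := fun p => rfl
  have hw : ∀ p : Plane, w p = p 1 - m * (p 0 + ε * p 1) := fun p => rfl
  simp only [← hw] at hL1 hL2 hR1 hR2
  simp only [← hu] at hLα hRα hε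
  have huw : ∀ p q, u p = u q → w p = w q → p = q := by
    intro p q h1 h2
    rw [hw, hw, ← hu, ← hu, h1] at h2
    have h3 : p 1 = q 1 := by linarith
    rw [hu, hu, h3] at h1
    ext i
    fin_cases i
    · exact add_right_cancel h1
    · exact h3
  have hline : ∀ T : Finset Plane, T ⊆ S → (T.filter fun p => w p = β).card ≤ 2 := by
    intro T hT
    by_contra! hlt
    obtain ⟨p, hp, q, hq, r, hr, hpq, hpr, hqr⟩ := Finset.two_lt_card.1 hlt
    rw [Finset.mem_filter] at hp hq hr
    refine hS p (hT hp.1) q (hT hq.1) r (hT hr.1) hpq hpr hqr ?_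
    rw [collinear_iff_of_mem (p₀ := p) (by simp)]
    refine ⟨!₂[1 - ε * m, m], fun z hz => ⟨u z - u p, ?_⟩⟩
    have hzw : w z = w p := by
      rcases hz with rfl | rfl | rfl
      · rfl
      · rw [hq.2, hp.2]
      · rw [hr.2, hp.2]
    refine huw _ _ ?_ ?_
    · simp only [vadd_eq_add, map_add, map_smul, smul_eq_mul]
      have : u !₂[1 - ε * m, m] = 1 := by simp [hu]
      rw [this]
      ring
    · simp only [vadd_eq_add, map_add, map_smul, smul_eq_mul]
      have : w !₂[1 - ε * m, m] = 0 := by simp [hw]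
      rw [this, hzw]
      ring
  have hcount : ∀ T : Finset Plane, T ⊆ S → T.card = 2 * (k + 1) + 1 →
      (T.filter fun p => w p < β).card ≤ k + 1 → (T.filter fun p => β < w p).card ≤ k + 1 →
      k ≤ (T.filter fun p => w p < β).card ∧ k ≤ (T.filter fun p => β < w p).card := by
    intro T hT hTc h1 h2
    have h3 := hline T hT
    have hcover : T ⊆ (T.filter fun p => w p < β) ∪ (T.filter fun p => w p = β) ∪
        (T.filter fun p => β < w p) := by
      intro p hp
      rcases lt_trichotomy (w p) β with h | h | h <;> simp [hp, h]
    have h4 := (Finset.card_le_card hcover).trans (Finset.card_union_le _ _)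
    have h5 := Finset.card_union_le (T.filter fun p => w p < β) (T.filter fun p => w p = β)
    omega
  obtain ⟨hLlow, hLup⟩ := hcount L hLS hL hL1 hL2
  obtain ⟨hRlow, hRup⟩ := hcount R hRS hR hR1 hR2
  have hinj : ∀ {T : Finset Plane} (P : Plane → Prop) [DecidablePred P], T ⊆ S →
      Set.InjOn u (T.filter P : Set Plane) := fun P _ hT =>
    Set.InjOn.mono (fun p hp => hT (Finset.mem_filter.1 hp).1) hε
  obtain ⟨a, haQ, ha⟩ := exists_strictMono_enum (hinj _ hRS) hRup
  obtain ⟨b, hbQ, hb⟩ := exists_strictMono_enum (hinj _ hLS) hLup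
  obtain ⟨c, hcQ, hc⟩ := exists_strictMono_enum (hinj _ hLS) hLlow
  obtain ⟨d, hdQ, hd⟩ := exists_strictMono_enum (hinj _ hRS) hRlow
  simp only [Finset.mem_filter] at haQ hbQ hcQ hdQ
  exact ⟨u, w, α, β, a, b, c, d, huw,
    fun i => ⟨hRα _ (haQ i).1, (haQ i).2, hLα _ (hbQ i).1, (hbQ i).2, hLα _ (hcQ i).1, (hcQ i).2,
      hRα _ (hdQ i).1, (hdQ i).2⟩,
    fun i => ⟨hRS (haQ i).1, hLS (hbQ i).1, hLS (hcQ i).1, hRS (hdQ i).1⟩, ha, hb, hc, hd⟩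

theorem exists_isCrossingFamily_card_eq {S : Finset Plane}
    (hS : InGeneralPosition (S : Set Plane)) {k : ℕ} (hk : 4 * k + 7 ≤ S.card) :
    ∃ F : Finset PlaneGraph,
      IsCrossingFamily (completeGeometricGraph S hS) (⊤ : SimpleGraph (Fin 4)) F ∧ F.card = k := by
  classical
  obtain ⟨u, w, α, β, a, b, c, d, huw, hquad, hmem, ha, hb, hc, hd⟩ := hS.exists_quadrants hk
  let V : Fin k → Finset Plane := fun i => {a i, b i, c i, d i}
  have hV : ∀ i, (V i : Set Plane) = {a i, b i, c i, d i} := fun i => by simp [V]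
  have hVS : ∀ i, (V i : Set Plane) ⊆ S := by
    intro i
    rw [hV]
    obtain ⟨h1, h2, h3, h4⟩ := hmem i
    rintro p (rfl | rfl | rfl | rfl) <;> assumption
  have hne : ∀ {e : Fin k → Plane}, (StrictMono fun i => u (e i)) → ∀ {i j}, i ≠ j → e i ≠ e j :=
    fun he _ _ hij h => hij (he.injective (congrArg u h))
  have hdisj : ∀ i j, i ≠ j → Disjoint (V i : Set Plane) (V j) := by
    intro i j hij
    rw [hV, hV]
    exact (hquad i).disjoint (hquad j) (hne ha hij) (hne hb hij) (hne hc hij) (hne hd hij)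
  have hlt : ∀ i j, i < j → (completeOn (V i)).Cross (completeOn (V j)) := by
    intro i j hij
    have h := (hquad i).exists_segments_meet (hquad j) huw (ha hij) (hb hij) (hc hij) (hd hij)
    rw [← hV, ← hV] at h
    rcases h with h | h
    · exact hS.cross_completeOn (hVS i) (hVS j) (hdisj i j hij.ne) h
    · exact (hS.cross_completeOn (hVS j) (hVS i) (hdisj j i hij.ne') h).symm
  have hcross : ∀ i j, i ≠ j → (completeOn (V i)).Cross (completeOn (V j)) := fun i j hij =>
    hij.lt_or_gt.elim (hlt i j) fun h => (hlt j i h).symm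
  have hinj : Function.Injective fun i => completeOn (V i : Set Plane) := by
    intro i j hij
    by_contra hne
    have h1 : (V i : Set Plane) = V j := congrArg SimpleGraph.Subgraph.verts hij
    have h2 : a i ∈ (V i : Set Plane) := by simp [hV]
    exact Set.disjoint_left.1 (hdisj i j hne) h2 (h1 ▸ h2)
  refine ⟨Finset.univ.image fun i => completeOn (V i : Set Plane), ⟨?_, ?_, ?_, ?_⟩, ?_⟩
  · simp only [Finset.mem_image, Finset.mem_univ, true_and, forall_exists_index,
      forall_apply_eq_imp_iff]
    exact fun i => ⟨hVS i, fun p q h => ⟨hVS i h.1, hVS i h.2.1, h.2.2⟩⟩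
  · simp only [Finset.mem_image, Finset.mem_univ, true_and, forall_exists_index,
      forall_apply_eq_imp_iff]
    exact fun i => completeOn_iso (hquad i).card_eq
  · simp only [Finset.mem_image, Finset.mem_univ, true_and, forall_exists_index,
      forall_apply_eq_imp_iff]
    exact fun i j hij => hdisj i j fun h => hij (h ▸ rfl)
  · simp only [Finset.mem_image, Finset.mem_univ, true_and, forall_exists_index,
      forall_apply_eq_imp_iff]
    exact fun i j hij => hcross i j fun h => hij (h ▸ rfl)
  · rw [Finset.card_image_of_injective _ hinj, Finset.card_fin]

theorem theorem3 (n : ℕ) (S : Finset Plane) (hn : S.card = n)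
    (hS : InGeneralPosition (S : Set Plane)) :
    (∃ F : Finset PlaneGraph,
      IsCrossingFamily (completeGeometricGraph S hS) (⊤ : SimpleGraph (Fin 4)) F ∧
        (n : ℝ) / 4 - 6 ≤ (F.card : ℝ)) ∧
    (∀ F : Finset PlaneGraph,
      IsCrossingFamily (completeGeometricGraph S hS) (⊤ : SimpleGraph (Fin 4)) F →
        (F.card : ℝ) ≤ (n : ℝ) / 4) := by
  refine ⟨?_, fun F hF => ?_⟩
  · rcases lt_or_ge n 7 with h7 | h7
    · refine ⟨∅, ⟨by simp, by simp, by simp, by simp⟩, ?_⟩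
      have : (n : ℝ) < 7 := by exact_mod_cast h7
      simp only [Finset.card_empty, Nat.cast_zero]
      linarith
    · obtain ⟨F, hF, hcard⟩ :=
        exists_isCrossingFamily_card_eq hS (k := (n - 7) / 4) (by omega)
      refine ⟨F, hF, ?_⟩
      have h : n ≤ 4 * F.card + 24 := by omega
      have h' : (n : ℝ) ≤ 4 * F.card + 24 := by exact_mod_cast h
      linarith
  · have h : 4 * F.card ≤ n := hn ▸ hF.four_mul_card_le
    have h' : 4 * (F.card : ℝ) ≤ n := by exact_mod_cast h
    linarith
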